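/- Let $R$ be the reversal map on finite binary words and $E$ the map that reverses a word and exchanges the letters $0$ and $1$. For $\vartheta\in\{E,R\}$ and $w\in\{0,1\}^*$ let $w^{\vartheta}$ be the shortest word $v$ with $\vartheta(v)=v$ that has $w$ as a prefix. Let $\mathbf u_p=\mathbf u(1^\omega,(EERR)^\omega)$ be the infinite binary word whose prefixes are the words $w_n$ given by $w_0=\varepsilon$ and $w_{n+1}=(w_n1)^{\vartheta_{n+1}}$ for $n\ge 0$, where $\vartheta_1\vartheta_2\vartheta_3\ldots=(EERR)^\omega=EERREERR\ldots$. Let $\mathcal C(n)$ be the number of factors (blocks of consecutive letters) of $\mathbf u_p$ of length $n$. Put $\tau=7+4\sqrt3$ and $\tau'=7-4\sqrt3$. Then $$\limsup_{n\to\infty}\frac{\mathcal C(n)}{n}\ \ge\ 4+\frac{\tau'+5}{\tau+5}\cdot\frac{2\tau}{\tau-1},\qquad\text{where}\qquad 4.57735\le 4+\frac{\tau'+5}{\tau+5}\cdot\frac{2\tau}{\tau-1}<4.577351 .$$ In particular, $\limsup_{n\to\infty}\mathcal C(n)/n\ge 4.57735$ and $\mathcal C(n)>4.5\,n$ for infinitely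 many $n\in\mathbb N$. -/

import Mathlib

open Filter

namespace PseudoStd

/-- Finite binary words; the letter `1` is `true`, the letter `0` is `false`. -/
abbrev Word := List Bool

/-- The two involutory antimorphisms over the binary alphabet:
the reversal map `R` and the exchange antimorphism `E`. -/
inductive Anti where
  | R : Anti
  | E : Anti

/-- The action on words: `R` reverses a word, `E` reverses it and exchanges `0` and `1`. -/
def Anti.app : Anti → Word → Word
  | Anti.R, w => w.reverse
  | Anti.E, w => (w.map not).reverse

/-- `w` is a `ϑ`-palindrome (a palindrome for `ϑ = R`, a pseudopalindrome for `ϑ = E`). -/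
def IsPal (ϑ : Anti) (w : Word) : Prop := ϑ.app w = w

instance (ϑ : Anti) (w : Word) : Decidable (IsPal ϑ w) :=
  inferInstanceAs (Decidable (ϑ.app w = w))

/-- `v` is a shortest `ϑ`-palindrome having `w` as a prefix. -/
def IsClosure (ϑ : Anti) (w v : Word) : Prop :=
  w <+: v ∧ IsPal ϑ v ∧ ∀ v' : Word, w <+: v' → IsPal ϑ v' → v.length ≤ v'.length

theorem Anti.app_append (ϑ : Anti) (v w : Word) : ϑ.app (v ++ w) = ϑ.app w ++ ϑ.app v := by
  cases ϑ <;> simp [Anti.app]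

theorem Anti.app_app (ϑ : Anti) (w : Word) : ϑ.app (ϑ.app w) = w := by
  cases ϑ <;> simp [Anti.app, Function.comp_def]

theorem Anti.length_app (ϑ : Anti) (w : Word) : (ϑ.app w).length = w.length := by
  cases ϑ <;> simp [Anti.app]

theorem exists_drop_isPal (ϑ : Anti) (w : Word) : ∃ i, IsPal ϑ (w.drop i) :=
  ⟨w.length, by cases ϑ <;> simp [IsPal, Anti.app]⟩

/-- The length of the prefix `p` in the factorisation `w = p s`, where `s` is the longest
`ϑ`-palindromic suffix of `w`. -/
def cut (ϑ : Anti) (w : Word) : ℕ := Nat.find (exists_drop_isPal ϑ w)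

/-- The `ϑ`-palindromic closure of `w`: the shortest `ϑ`-palindrome having `w` as a prefix
(see `closure_isClosure` and `eq_closure_of_isClosure`). It is given as `p s ϑ(p)` where
`w = p s` and `s` is the longest `ϑ`-palindromic suffix of `w`. -/
def closure (ϑ : Anti) (w : Word) : Word := w ++ ϑ.app (w.take (cut ϑ w))

theorem prefix_closure (ϑ : Anti) (w : Word) : w <+: closure ϑ w := List.prefix_append _ _

/-- A `ϑ`-palindrome `v` with prefix `w` and length at most `2 |w|` arises from a
`ϑ`-palindromic suffix of `w`. -/
theorem isPal_append_iff (ϑ : Anti) (w x : Word) (hx : x.length ≤ w.length) :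
    IsPal ϑ (w ++ x) ↔ x = ϑ.app (w.take x.length) ∧ IsPal ϑ (w.drop x.length) := by
  have h1 : w = w.take x.length ++ w.drop x.length := (List.take_append_drop _ _).symm
  have hlen : (w.take x.length).length = x.length := by simp [hx]
  generalize hp : w.take x.length = p at *
  generalize hs : w.drop x.length = s at *
  subst h1
  unfold IsPal
  rw [Anti.app_append, Anti.app_append, List.append_assoc]
  constructor
  · intro h
    obtain ⟨ha, hb⟩ := List.append_inj h (by rw [Anti.length_app, hlen])
    obtain ⟨hc, hd⟩ := List.append_inj hb (by rw [Anti.length_app])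
    exact ⟨hd.symm, hc⟩
  · rintro ⟨ha, hb⟩
    rw [hb, ← ha, ha, Anti.app_app]

theorem cut_le (ϑ : Anti) (w : Word) : cut ϑ w ≤ w.length :=
  Nat.find_min' _ (by cases ϑ <;> simp [IsPal, Anti.app])

theorem closure_isClosure (ϑ : Anti) (w : Word) : IsClosure ϑ w (closure ϑ w) := by
  have hl : (ϑ.app (w.take (cut ϑ w))).length = cut ϑ w := by
    rw [Anti.length_app, List.length_take, min_eq_left (cut_le ϑ w)]
  refine ⟨prefix_closure ϑ w, ?_, ?_⟩
  · unfold closure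
    rw [isPal_append_iff _ _ _ (by rw [hl]; exact cut_le ϑ w), hl]
    exact ⟨rfl, Nat.find_spec (exists_drop_isPal ϑ w)⟩
  · rintro _ ⟨x, rfl⟩ hv
    unfold closure
    rw [List.length_append, List.length_append, hl]
    by_cases hx : x.length ≤ w.length
    · have h := (isPal_append_iff ϑ w x hx).1 hv
      have : cut ϑ w ≤ x.length := Nat.find_min' _ h.2
      omega
    · have := cut_le ϑ w
      omega

/-- The shortest `ϑ`-palindrome having `w` as a prefix is unique. -/
theorem eq_closure_of_isClosure (ϑ : Anti) (w v : Word) (h : IsClosure ϑ w v) :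
    v = closure ϑ w := by
  have hc := closure_isClosure ϑ w
  have hlen : v.length = (closure ϑ w).length :=
    le_antisymm (h.2.2 _ hc.1 hc.2.1) (hc.2.2 _ h.1 h.2.1)
  have hl : (ϑ.app (w.take (cut ϑ w))).length = cut ϑ w := by
    rw [Anti.length_app, List.length_take, min_eq_left (cut_le ϑ w)]
  obtain ⟨x, rfl⟩ := h.1
  have hx : x.length = cut ϑ w := by
    unfold closure at hlen
    rw [List.length_append, List.length_append, hl] at hlen
    omega
  have h2 := ((isPal_append_iff ϑ w x (by rw [hx]; exact cut_le ϑ w)).1 h.2.1).1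
  unfold closure
  rw [h2, hx]

/-- The prefixes `w_n` of the generalized pseudostandard word with directive bi-sequence
`(Δ, Θ)`: `w_0` is empty and `w_{n+1} = (w_n δ_{n+1})^{ϑ_{n+1}}`. The sequences `Δ` and `Θ` are
indexed from `0` here, so that `Δ n` is `δ_{n+1}` and `Θ n` is `ϑ_{n+1}`. -/
def pre (Δ : ℕ → Bool) (Θ : ℕ → Anti) : ℕ → Word
  | 0 => []
  | n + 1 => closure (Θ n) (pre Δ Θ n ++ [Δ n])

theorem pre_append_prefix_succ (Δ : ℕ → Bool) (Θ : ℕ → Anti) (n : ℕ) :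
    pre Δ Θ n ++ [Δ n] <+: pre Δ Θ (n + 1) := prefix_closure _ _

theorem pre_prefix_of_le (Δ : ℕ → Bool) (Θ : ℕ → Anti) {m n : ℕ} (h : m ≤ n) :
    pre Δ Θ m <+: pre Δ Θ n := by
  induction n, h using Nat.le_induction with
  | base => exact List.prefix_rfl
  | succ k _ ih =>
    exact ih.trans ((List.prefix_append _ _).trans (pre_append_prefix_succ Δ Θ k))

theorem le_length_pre (Δ : ℕ → Bool) (Θ : ℕ → Anti) (n : ℕ) : n ≤ (pre Δ Θ n).length := by
  induction n with
  | zero => simp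
  | succ k ih =>
    have := (pre_append_prefix_succ Δ Θ k).length_le
    rw [List.length_append, List.length_singleton] at this
    omega

/-- The generalized pseudostandard word `u(Δ, Θ)`: the infinite word all of whose prefixes of
length `|w_n|` are the words `w_n = pre Δ Θ n` (see `genPseudoStd_prefix`). -/
def genPseudoStd (Δ : ℕ → Bool) (Θ : ℕ → Anti) (i : ℕ) : Bool :=
  (pre Δ Θ (i + 1))[i]'(le_length_pre Δ Θ (i + 1))

theorem genPseudoStd_prefix (Δ : ℕ → Bool) (Θ : ℕ → Anti) (n i : ℕ)
    (hi : i < (pre Δ Θ n).length) : (pre Δ Θ n)[i] = genPseudoStd Δ Θ i := by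
  unfold genPseudoStd
  rcases le_total n (i + 1) with h | h
  · exact (pre_prefix_of_le Δ Θ h).getElem hi
  · exact ((pre_prefix_of_le Δ Θ h).getElem _).symm

/-- The finite word `w` is a factor of the infinite word `u`:
`w = u_i u_{i+1} ... u_{i+|w|-1}` for some `i`. -/
def IsFactor (u : ℕ → Bool) (w : Word) : Prop :=
  ∃ i : ℕ, w = (List.range w.length).map (fun j => u (i + j))

/-- The factor complexity of `u`: the number of factors of `u` of length `n`. -/
noncomputable def complexity (u : ℕ → Bool) (n : ℕ) : ℕ :=
  {w : Word | w.length = n ∧ IsFactor u w}.ncard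

/-- The set of factors of a given length is finite, so that the cardinal number above is the
true number of factors. -/
theorem finite_factors (u : ℕ → Bool) (n : ℕ) :
    {w : Word | w.length = n ∧ IsFactor u w}.Finite :=
  (List.finite_length_eq Bool n).subset fun _ hw => hw.1

/-- The purely periodic sequence `v^ω = v v v ...` of a nonempty finite sequence `v`. -/
def omegaPow {α : Type} (v : List α) (hv : v ≠ []) (n : ℕ) : α :=
  v[n % v.length]'(Nat.mod_lt _ (List.length_pos_of_ne_nil hv))

/-- The word `u_p = u(1^ω, (EERR)^ω)`. -/
def up : ℕ → Bool :=
  genPseudoStd (omegaPow [true] (by simp))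
    (omegaPow [Anti.E, Anti.E, Anti.R, Anti.R] (by simp))

/-- The number `τ`, the larger root of `x ^ 2 - 14 x + 1`. -/
noncomputable def tau : ℝ := 7 + 4 * Real.sqrt 3

/-- The number `τ'`, the smaller root of `x ^ 2 - 14 x + 1`. -/
noncomputable def tau' : ℝ := 7 - 4 * Real.sqrt 3

end PseudoStd

namespace PseudoStd

/-! Count left special factors. Every factor of `up` extends to the left, so C(n+1) - C(n) is at
least the number of left special factors of length n. All prefixes of `up` and their complements are
left special, which contributes 2. The rest of the bound comes from branches: for each p a left
special word agrees with `up` on exactly the first x_p = |w_{2p+1}| letters and stays left special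
up to length x_p + x_{p+1} - 3 (`exists_branch`). With its complement it contributes 2 more at every
length in between. Summation gives `complexity_ge`.

A branch arises from a window of `up` that is a palindrome of one type but whose two neighbouring
letters are incompatible with that type (`leftSpecial_of_winPal`). Finding these windows requires
the exact shape of the w_n. Knowing all palindromic and pseudopalindromic prefixes determines the
longest ϑ-palindromic suffix of w_n 1, hence |w_{n+1}|; `prefixStructure` carries out this
simultaneous induction over one period EERR.

The length recurrences combine to x_{p+2} + x_p = 4 x_{p+1} + O(1), so x_p grows with ratio 2 + √3,
whose square is τ. At n = x_q + x_{q+1} the lower bound is (4 + √3/3) n - O(q), and 4 + √3/3 is the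
stated constant (`tau_quotient`). Since n grows exponentially in q, the error disappears in the
limit superior. -/

/-- Whether an antimorphism exchanges the letters: `E` does, `R` does not. -/
def Anti.flip : Anti → Bool
  | Anti.R => false
  | Anti.E => true

/-- The window `[i, j)` of `u` is a palindrome (`e = false`) or a pseudopalindrome (`e = true`). -/
def WinPal (u : ℕ → Bool) (e : Bool) (i j : ℕ) : Prop :=
  ∀ x y, i ≤ x → i ≤ y → x + y + 1 = i + j → u x = (e ^^ u y)

theorem isPal_iff_getElem (ϑ : Anti) (w : Word) :
    IsPal ϑ w ↔ ∀ x y (hx : x < w.length) (hy : y < w.length), x + y + 1 = w.length →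
      w[x] = (ϑ.flip ^^ w[y]) := by
  unfold IsPal
  constructor
  · intro h x y hx hy hxy
    have hy' : y = w.length - 1 - x := by omega
    have hx' : x < (ϑ.app w).length := by rw [Anti.length_app]; exact hx
    have h2 : (ϑ.app w)[x] = w[x] := by simp only [h]
    rw [← h2]
    subst hy'
    cases ϑ <;> simp [Anti.app, Anti.flip]
  · intro h
    refine List.ext_getElem (Anti.length_app _ _) fun x h1 h2 => ?_
    rw [h x (w.length - 1 - x) h2 (by omega) (by omega)]
    cases ϑ <;> simp [Anti.app, Anti.flip]

/-! ### Palindromic closure in terms of windows of the infinite word -/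

section general

variable (Δ : ℕ → Bool) (Θ : ℕ → Anti)

theorem genPseudoStd_length_pre (n : ℕ) :
    genPseudoStd Δ Θ (pre Δ Θ n).length = Δ n := by
  have hp := pre_append_prefix_succ Δ Θ n
  have hl := hp.length_le
  simp only [List.length_append, List.length_singleton] at hl
  rw [← genPseudoStd_prefix Δ Θ (n + 1) _ (by omega), ← hp.getElem (by simp)]
  simp

theorem getElem_pre_append (n x : ℕ) (hx : x < (pre Δ Θ n ++ [Δ n]).length) :
    (pre Δ Θ n ++ [Δ n])[x] = genPseudoStd Δ Θ x := by
  have hp := pre_append_prefix_succ Δ Θ n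
  rw [hp.getElem hx, genPseudoStd_prefix]

theorem isPal_drop_iff (ϑ : Anti) (n i : ℕ) (hi : i ≤ (pre Δ Θ n).length + 1) :
    IsPal ϑ ((pre Δ Θ n ++ [Δ n]).drop i) ↔
      WinPal (genPseudoStd Δ Θ) ϑ.flip i ((pre Δ Θ n).length + 1) := by
  rw [isPal_iff_getElem]
  simp only [List.length_drop, List.getElem_drop, getElem_pre_append, List.length_append,
    List.length_singleton]
  constructor
  · intro h x y hx hy hxy
    have := h (x - i) (y - i) (by omega) (by omega) (by omega)
    rwa [Nat.add_sub_cancel' hx, Nat.add_sub_cancel' hy] at this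
  · intro h x y hx hy hxy
    exact h _ _ (by omega) (by omega) (by omega)

theorem isPal_pre_iff (ϑ : Anti) (n : ℕ) :
    IsPal ϑ (pre Δ Θ n) ↔ WinPal (genPseudoStd Δ Θ) ϑ.flip 0 (pre Δ Θ n).length := by
  rw [isPal_iff_getElem]
  simp only [genPseudoStd_prefix]
  constructor
  · intro h x y _ _ hxy
    exact h x y (by omega) (by omega) (by omega)
  · intro h x y hx hy hxy
    exact h _ _ (by omega) (by omega) (by omega)

theorem winPal_pre_succ (n : ℕ) :
    WinPal (genPseudoStd Δ Θ) (Θ n).flip 0 (pre Δ Θ (n + 1)).length :=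
  (isPal_pre_iff Δ Θ _ _).1 (closure_isClosure (Θ n) (pre Δ Θ n ++ [Δ n])).2.1

theorem length_pre_succ (n i : ℕ) (hi : i ≤ (pre Δ Θ n).length + 1)
    (hp : WinPal (genPseudoStd Δ Θ) (Θ n).flip i ((pre Δ Θ n).length + 1))
    (hm : ∀ j < i, ¬ WinPal (genPseudoStd Δ Θ) (Θ n).flip j ((pre Δ Θ n).length + 1)) :
    (pre Δ Θ (n + 1)).length = (pre Δ Θ n).length + 1 + i := by
  have hc : cut (Θ n) (pre Δ Θ n ++ [Δ n]) = i := by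
    refine (Nat.find_eq_iff _).2 ⟨(isPal_drop_iff Δ Θ _ _ _ hi).2 hp, fun j hj h => ?_⟩
    exact hm j hj ((isPal_drop_iff Δ Θ _ _ _ (by omega)).1 h)
  change (closure (Θ n) (pre Δ Θ n ++ [Δ n])).length = _
  unfold closure
  rw [hc, List.length_append, Anti.length_app, List.length_take, List.length_append,
    List.length_singleton, min_eq_left hi]

end general


theorem WinPal.eq {u : ℕ → Bool} {i j : ℕ} (h : WinPal u false i j) (x y : ℕ) (hx : i ≤ x)
    (hy : i ≤ y) (hxy : x + y + 1 = i + j) : u x = u y := by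
  simpa using h x y hx hy hxy

theorem WinPal.eq_not {u : ℕ → Bool} {i j : ℕ} (h : WinPal u true i j) (x y : ℕ) (hx : i ≤ x)
    (hy : i ≤ y) (hxy : x + y + 1 = i + j) : u x = !u y := by
  simpa using h x y hx hy hxy

/-! ### Lengths and palindromicity of the prefixes w_n -/

/-- The length of the prefix `w_n` of `up`. -/
def len (n : ℕ) : ℕ :=
  (pre (omegaPow [true] (by simp)) (omegaPow [Anti.E, Anti.E, Anti.R, Anti.R] (by simp)) n).length

theorem len_zero : len 0 = 0 := rfl

theorem up_len (n : ℕ) : up (len n) = true := by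
  unfold up len
  rw [genPseudoStd_length_pre]
  simp [omegaPow]

theorem len_lt_succ (n : ℕ) : len n < len (n + 1) := by
  have := (pre_append_prefix_succ (omegaPow [true] (by simp))
    (omegaPow [Anti.E, Anti.E, Anti.R, Anti.R] (by simp)) n).length_le
  simp only [List.length_append, List.length_singleton] at this
  unfold len
  omega

theorem len_strictMono : StrictMono len := strictMono_nat_of_lt_succ len_lt_succ

theorem flip_directive (n : ℕ) :
    (omegaPow [Anti.E, Anti.E, Anti.R, Anti.R] (by simp) n).flip = decide (n % 4 < 2) := by
  have key : ∀ r (h : r < 4),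
      ([Anti.E, Anti.E, Anti.R, Anti.R][r]'h).flip = decide (r < 2) := by
    intro r h
    interval_cases r <;> rfl
  exact key _ (Nat.mod_lt _ (by norm_num))

theorem winPal_len_succ (n : ℕ) : WinPal up (decide (n % 4 < 2)) 0 (len (n + 1)) := by
  rw [← flip_directive]
  exact winPal_pre_succ _ _ n

theorem len_succ_eq (n i : ℕ) (hi : i ≤ len n + 1)
    (hp : WinPal up (decide (n % 4 < 2)) i (len n + 1))
    (hm : ∀ j < i, ¬ WinPal up (decide (n % 4 < 2)) j (len n + 1)) :
    len (n + 1) = len n + 1 + i := by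
  simp only [← flip_directive] at hp hm
  exact length_pre_succ _ _ n i hi hp hm

/-- Minimality of the closure: no prefix of the type of w_{n+1} has length strictly between |w_n|
and |w_{n+1}|. -/
theorem len_succ_le (n m : ℕ) (h : WinPal up (decide (n % 4 < 2)) 0 m) (hm : len n < m) :
    len (n + 1) ≤ m := by
  classical
  have hex : ∃ i, i ≤ len n + 1 ∧ WinPal up (decide (n % 4 < 2)) i (len n + 1) :=
    ⟨len n + 1, le_rfl, fun x y _ _ _ => by omega⟩
  have hs := Nat.find_spec hex
  rw [len_succ_eq n (Nat.find hex) hs.1 hs.2 fun j hj hj' =>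
    Nat.find_min hex hj ⟨by omega, hj'⟩]
  by_contra hlt
  exact Nat.find_min hex (m := m - (len n + 1)) (by omega)
    ⟨by omega, fun x y hx hy hxy => h x y (by omega) (by omega) (by omega)⟩

theorem winPal_len_one (k : ℕ) : WinPal up true 0 (len (4 * k + 1)) := by
  have := winPal_len_succ (4 * k)
  rwa [decide_eq_true (by omega)] at this

theorem winPal_len_two (k : ℕ) : WinPal up true 0 (len (4 * k + 2)) := by
  have := winPal_len_succ (4 * k + 1)
  rwa [decide_eq_true (by omega)] at this

theorem winPal_len_three (k : ℕ) : WinPal up false 0 (len (4 * k + 3)) := by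
  have := winPal_len_succ (4 * k + 2)
  rwa [decide_eq_false (by omega)] at this

theorem winPal_len_four (k : ℕ) : WinPal up false 0 (len (4 * k + 4)) := by
  have := winPal_len_succ (4 * k + 3)
  rwa [decide_eq_false (by omega)] at this

theorem up_zero : up 0 = true := up_len 0

theorem len_one : len 1 = 2 := by
  have := len_succ_eq 0 1 (by rw [len_zero]) (fun x y _ _ _ => by rw [len_zero] at *; omega)
    (fun j hj h => by
      have := h 0 0 (by omega) (by omega) (by rw [len_zero]; omega)
      simp [up_zero] at this)
  rw [this, len_zero]

theorem up_one : up 1 = false := by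
  rw [(winPal_len_one 0).eq_not 1 0 (by omega) (by omega) (by simp [len_one]), up_zero]; rfl

theorem up_two : up 2 = true := by
  have := up_len 1
  rwa [len_one] at this

theorem len_two : len 2 = 4 := by
  have := len_succ_eq 1 1 (by rw [len_one]; omega)
    (fun x y hx hy hxy => by
      rw [len_one] at hxy
      obtain ⟨rfl, rfl⟩ | ⟨rfl, rfl⟩ : (x = 1 ∧ y = 2) ∨ (x = 2 ∧ y = 1) := by omega
      · simp [up_one, up_two]
      · simp [up_one, up_two])
    (fun j hj h => by
      have := h 1 1 (by omega) (by omega) (by rw [len_one]; omega)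
      simp at this)
  rw [this, len_one]

theorem up_three : up 3 = false := by
  rw [(winPal_len_two 0).eq_not 3 0 (by omega) (by omega) (by simp [len_two]), up_zero]; rfl

theorem up_four : up 4 = true := by
  have := up_len 2
  rwa [len_two] at this

theorem len_three : len 3 = 5 := by
  have := len_succ_eq 2 0 (by rw [len_two]; omega)
    (fun x y hx hy hxy => by
      rw [len_two] at hxy
      have hx5 : x < 5 := by omega
      obtain rfl : y = 4 - x := by omega
      interval_cases x <;> simp [up_zero, up_one, up_two, up_three, up_four])
    (fun j hj h => by omega)
  rw [this, len_two]

/-! ### Classification of palindromic prefixes and recurrences for the lengths -/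

/-- The palindromic and pseudopalindromic prefixes of `w_n`, and the lengths up to `w_n`. -/
structure PrefixStructure (n : ℕ) : Prop where
  pseudo : ∀ m ≤ len n, 0 < m → WinPal up true 0 m →
    ∃ i ≤ n, m = len i ∧ (i % 4 = 1 ∨ i % 4 = 2)
  -- The exceptional palindromes 1 and 101 are followed by 0; every other prefix in either list is
  -- some w_i and so is followed by 1.
  pal : ∀ m ≤ len n, 0 < m → WinPal up false 0 m →
    m = 1 ∨ m = 3 ∨ ∃ i ≤ n, m = len i ∧ 0 < i ∧ (i % 4 = 3 ∨ i % 4 = 0)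
  one : ∀ k, 4 * k + 1 ≤ n → len (4 * k + 1) = 2 * len (4 * k) + 2
  two : ∀ k, 4 * k + 6 ≤ n → len (4 * k + 6) + len (4 * k + 2) = 2 * len (4 * k + 5)
  three : ∀ k, 4 * k + 3 ≤ n → len (4 * k + 3) + 3 = 2 * len (4 * k + 2)
  four : ∀ k, 4 * k + 4 ≤ n → len (4 * k + 4) + len (4 * k) = 2 * len (4 * k + 3)
  -- Parity and the two letters 10 right of the centre serve only to exclude prefixes of the wrong
  -- type in the induction.
  even : ∀ k, 4 * k ≤ n → len (4 * k) % 2 = 0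
  center : ∀ k, 4 * k + 2 ≤ n → ∃ h, 2 ≤ h ∧ len (4 * k + 2) = 2 * h ∧ up h = true ∧
    up (h + 1) = false

theorem prefixStructure_three : PrefixStructure 3 where
  pseudo m hm h0 h := by
    rw [len_three] at hm
    interval_cases m
    · simpa using h 0 0
    · exact ⟨1, by omega, len_one.symm, by omega⟩
    · simpa using h 1 1
    · exact ⟨2, by omega, len_two.symm, by omega⟩
    · simpa using h 2 2
  pal m hm h0 h := by
    rw [len_three] at hm
    interval_cases m
    · omega
    · simpa [up_zero, up_one] using h 0 1
    · omega
    · simpa [up_zero, up_three] using h 0 3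
    · exact .inr (.inr ⟨3, by omega, len_three.symm, by omega⟩)
  one k hk := by
    obtain rfl : k = 0 := by omega
    rw [len_one, len_zero]
  two k hk := by omega
  three k hk := by
    obtain rfl : k = 0 := by omega
    rw [len_three, len_two]
  four k hk := by omega
  even k hk := by
    obtain rfl : k = 0 := by omega
    rw [len_zero]
  center k hk := by
    obtain rfl : k = 0 := by omega
    exact ⟨2, le_rfl, len_two, up_two, up_three⟩

namespace PrefixStructure

variable {n : ℕ}

theorem up_pseudo (P : PrefixStructure n) {m : ℕ} (hm : m ≤ len n) (h : WinPal up true 0 m) :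
    up m = true := by
  rcases Nat.eq_zero_or_pos m with rfl | h0
  · exact up_zero
  · obtain ⟨i, -, rfl, -⟩ := P.pseudo m hm h0 h
    exact up_len i

/-- The lists of palindromic prefixes pass from `w_n` to `w_{n+1}` as soon as no prefix of
intermediate length is a palindrome of the type different from that of `w_{n+1}`. -/
theorem lists_succ (P : PrefixStructure n)
    (ho : ∀ m, len n < m → m < len (n + 1) → ¬ WinPal up (!decide (n % 4 < 2)) 0 m) :
    (∀ m ≤ len (n + 1), 0 < m → WinPal up true 0 m →
      ∃ i ≤ n + 1, m = len i ∧ (i % 4 = 1 ∨ i % 4 = 2)) ∧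
    (∀ m ≤ len (n + 1), 0 < m → WinPal up false 0 m →
      m = 1 ∨ m = 3 ∨ ∃ i ≤ n + 1, m = len i ∧ 0 < i ∧ (i % 4 = 3 ∨ i % 4 = 0)) := by
  have hN := winPal_len_succ n
  have key : ∀ m ≤ len (n + 1), len n < m → ∀ e, WinPal up e 0 m →
      m = len (n + 1) ∧ e = decide (n % 4 < 2) := by
    intro m hm hlt e he
    by_cases hee : e = decide (n % 4 < 2)
    · subst hee
      exact ⟨le_antisymm hm (len_succ_le n m he hlt), rfl⟩
    · have hne : e = !decide (n % 4 < 2) := by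
        revert hee; cases e <;> cases decide (n % 4 < 2) <;> simp
      rcases hm.lt_or_eq with h | h
      · exact absurd (hne ▸ he) (ho m hlt h)
      · exfalso
        subst h
        have h1 := hN 0 (len (n + 1) - 1) (by omega) (by omega) (by omega)
        have h2 := he 0 (len (n + 1) - 1) (by omega) (by omega) (by omega)
        rw [hne, h1] at h2
        revert h2
        cases decide (n % 4 < 2) <;> cases up (len (n + 1) - 1) <;> simp
  constructor
  · intro m hm h0 h
    rcases le_or_gt m (len n) with hle | hlt
    · obtain ⟨i, hi, h'⟩ := P.pseudo m hle h0 h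
      exact ⟨i, by omega, h'⟩
    · obtain ⟨h1, h2⟩ := key m hm hlt _ h
      have := of_decide_eq_true h2.symm
      exact ⟨n + 1, le_rfl, h1, by omega⟩
  · intro m hm h0 h
    rcases le_or_gt m (len n) with hle | hlt
    · rcases P.pal m hle h0 h with h | h | ⟨i, hi, h'⟩
      · exact .inl h
      · exact .inr (.inl h)
      · exact .inr (.inr ⟨i, by omega, h'⟩)
    · obtain ⟨h1, h2⟩ := key m hm hlt _ h
      have := of_decide_eq_false h2.symm
      exact .inr (.inr ⟨n + 1, le_rfl, h1, by omega, by omega⟩)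

end PrefixStructure

/-- If a word of length `N` is a `ϑ`-palindrome and its prefix of length `m` is a palindrome of the
other type, then the central window of length `2 m - N` is the complement of a prefix of `u`, which
is a `ϑ`-palindrome. -/
theorem WinPal.center {u : ℕ → Bool} {e : Bool} {m N : ℕ} (hN : WinPal u e 0 N)
    (hm : WinPal u (!e) 0 m) (hmN : m ≤ N) :
    WinPal u e 0 (2 * m - N) ∧ ∀ x < 2 * m - N, u (N - m + x) = !u x := by
  have hc : ∀ x < 2 * m - N, u (N - m + x) = !u x := by
    intro x hx
    rw [hN (N - m + x) (m - 1 - x) (by omega) (by omega) (by omega),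
      hm (m - 1 - x) x (by omega) (by omega) (by omega)]
    cases e <;> cases u x <;> rfl
  refine ⟨fun x y _ _ hxy => ?_, hc⟩
  have h := hN (N - m + x) (N - m + y) (by omega) (by omega) (by omega)
  rw [hc x (by omega), hc y (by omega)] at h
  revert h
  cases e <;> cases u x <;> cases u y <;> simp


namespace PrefixStructure

/-- The longest pseudopalindromic suffix of w_{4k} 1 is empty. Stripping the outer letters of a
nonempty one and reflecting in w_{4k} would give a pseudopalindromic prefix followed by 0, against
`up_pseudo`. Hence w_{4k+1} = w_{4k} 1 0 followed by the complement of w_{4k}. -/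
theorem succ_zero {k : ℕ} (hk : 0 < k) (P : PrefixStructure (4 * k)) :
    PrefixStructure (4 * k + 1) := by
  have hd : decide (4 * k % 4 < 2) = true := decide_eq_true (by omega)
  have hA : WinPal up false 0 (len (4 * k)) := by
    obtain ⟨k, rfl⟩ : ∃ j, k = j + 1 := ⟨k - 1, by omega⟩
    exact winPal_len_four k
  have ha : up (len (4 * k)) = true := up_len _
  have hpos : 4 < len (4 * k) := by
    have := len_strictMono (show 2 < 4 * k by omega)
    rwa [len_two] at this
  have hB := winPal_len_one k
  have hl : len (4 * k + 1) = 2 * len (4 * k) + 2 := by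
    rw [len_succ_eq (4 * k) (len (4 * k) + 1) le_rfl (fun x y _ _ _ => by omega)]
    · omega
    · rw [hd]
      intro i hi h
      rcases Nat.lt_or_ge i (len (4 * k)) with hlt | hge
      · have hr : WinPal up true 0 (len (4 * k) - 1 - i) := fun x y _ _ hxy => by
          rw [hA.eq x (len (4 * k) - 1 - x) (by omega) (by omega) (by omega),
            hA.eq y (len (4 * k) - 1 - y) (by omega) (by omega) (by omega)]
          exact h _ _ (by omega) (by omega) (by omega)
        have h1 := P.up_pseudo (by omega) hr
        rw [hA.eq _ i (by omega) (by omega) (by omega),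
          h.eq_not i (len (4 * k)) (by omega) (by omega) (by omega), ha] at h1
        simp at h1
      · obtain rfl : i = len (4 * k) := by omega
        have := h.eq_not _ _ le_rfl le_rfl rfl
        simp at this
  have ho := P.lists_succ (fun m h1 h2 h => by
    rw [hd, Bool.not_true] at h
    rcases Nat.lt_or_ge m (len (4 * k) + 2) with hlt | hge
    · obtain rfl : m = len (4 * k) + 1 := by omega
      have e1 := h.eq 1 (len (4 * k) - 1) (by omega) (by omega) (by omega)
      rw [← hA.eq 0 (len (4 * k) - 1) (by omega) (by omega) (by omega), up_zero, up_one] at e1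
      simp at e1
    · obtain ⟨r, rfl⟩ : ∃ r, m = len (4 * k) + 2 + r := ⟨_, (Nat.add_sub_cancel' hge).symm⟩
      have hr : WinPal up true 0 r := fun x y _ _ hxy => by
        rw [h.eq x (len (4 * k) + 2 + y) (by omega) (by omega) (by omega),
          hB.eq_not (len (4 * k) + 2 + y) (len (4 * k) - 1 - y) (by omega) (by omega) (by omega),
          hA.eq (len (4 * k) - 1 - y) y (by omega) (by omega) (by omega)]
        simp
      have e := P.up_pseudo (by omega) hr
      rw [h.eq r (len (4 * k) + 1) (by omega) (by omega) (by omega),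
        hB.eq_not (len (4 * k) + 1) (len (4 * k)) (by omega) (by omega) (by omega), ha] at e
      simp at e)
  refine ⟨ho.1, ho.2, fun j hj => ?_, fun j hj => P.two j (by omega),
    fun j hj => P.three j (by omega), fun j hj => P.four j (by omega),
    fun j hj => P.even j (by omega), fun j hj => P.center j (by omega)⟩
  rcases Nat.lt_or_ge j k with h | h
  · exact P.one j (by omega)
  · obtain rfl : j = k := by omega
    exact hl

/-- The longest pseudopalindromic suffix of w_{4k+5} 1 is 0 w_{4k+2} 1: a longer one, stripped and
reflected, would be a pseudopalindromic prefix strictly between w_{4k+2} and w_{4k+5}. -/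
theorem succ_one {k : ℕ} (P : PrefixStructure (4 * k + 5)) : PrefixStructure (4 * k + 6) := by
  have hd : decide ((4 * k + 5) % 4 < 2) = true := decide_eq_true (by omega)
  have hC : WinPal up true 0 (len (4 * k + 2)) := winPal_len_two k
  have hB : WinPal up true 0 (len (4 * k + 5)) := winPal_len_one (k + 1)
  have hA : WinPal up false 0 (len (4 * k + 4)) := winPal_len_four k
  have hN : WinPal up true 0 (len (4 * k + 6)) := winPal_len_two (k + 1)
  have hc : up (len (4 * k + 2)) = true := up_len _
  have hb : up (len (4 * k + 5)) = true := up_len _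
  have hcb : len (4 * k + 2) + 2 < len (4 * k + 5) := by
    have h1 := len_lt_succ (4 * k + 2)
    have h2 := len_lt_succ (4 * k + 3)
    have h3 := len_lt_succ (4 * k + 4)
    simp only [add_assoc, Nat.reduceAdd] at h1 h2 h3
    omega
  have hab : len (4 * k + 5) = 2 * len (4 * k + 4) + 2 := P.one (k + 1) (by omega)
  have ha4 : len 2 < len (4 * k + 4) := len_strictMono (by omega)
  rw [len_two] at ha4
  have hnext : ∀ r, len (4 * k + 2) < r → r ≤ len (4 * k + 5) → WinPal up true 0 r →
      r = len (4 * k + 5) := by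
    intro r h1 h2 h
    obtain ⟨i, hi, rfl, hi'⟩ := P.pseudo r h2 (by omega) h
    have := len_strictMono.lt_iff_lt.1 h1
    obtain rfl : i = 4 * k + 5 := by omega
    rfl
  have hl : len (4 * k + 6) = len (4 * k + 5) + 1 + (len (4 * k + 5) - len (4 * k + 2) - 1) := by
    refine len_succ_eq (4 * k + 5) _ (by omega) ?_ ?_ <;> rw [hd]
    · have inner : ∀ x, len (4 * k + 5) - len (4 * k + 2) ≤ x → x < len (4 * k + 5) →
          up x = up (x - (len (4 * k + 5) - len (4 * k + 2))) := fun x h1 h2 => by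
        rw [hB.eq_not x (len (4 * k + 5) - 1 - x) (by omega) (by omega) (by omega),
          hC.eq_not (len (4 * k + 5) - 1 - x) (x - (len (4 * k + 5) - len (4 * k + 2)))
            (by omega) (by omega) (by omega), Bool.not_not]
      have hleft : up (len (4 * k + 5) - len (4 * k + 2) - 1) = false := by
        rw [hB.eq_not _ (len (4 * k + 2)) (by omega) (by omega) (by omega), hc]; rfl
      intro x y hx hy hxy
      rw [Bool.true_xor]
      rcases Nat.lt_or_ge x (len (4 * k + 5) - len (4 * k + 2)) with h | h
      · obtain rfl : x = len (4 * k + 5) - len (4 * k + 2) - 1 := by omega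
        obtain rfl : y = len (4 * k + 5) := by omega
        rw [hleft, hb]; rfl
      rcases Nat.lt_or_ge y (len (4 * k + 5) - len (4 * k + 2)) with h' | h'
      · obtain rfl : y = len (4 * k + 5) - len (4 * k + 2) - 1 := by omega
        obtain rfl : x = len (4 * k + 5) := by omega
        rw [hleft, hb]; rfl
      rw [inner x h (by omega), inner y h' (by omega)]
      exact hC.eq_not _ _ (by omega) (by omega) (by omega)
    · intro i hi h
      have hr : WinPal up true 0 (len (4 * k + 5) - 1 - i) := fun x y _ _ hxy => by
        rw [hB.eq_not x (len (4 * k + 5) - 1 - x) (by omega) (by omega) (by omega),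
          hB.eq_not y (len (4 * k + 5) - 1 - y) (by omega) (by omega) (by omega),
          h.eq_not (len (4 * k + 5) - 1 - x) (len (4 * k + 5) - 1 - y)
            (by omega) (by omega) (by omega)]
        simp
      have := hnext _ (by omega) (by omega) hr
      omega
  obtain ⟨h, h2, hh, hu, hu'⟩ := P.center k (by omega)
  -- The midpoint of w_{4k+6} is |w_{4k+5}| - h, and the letters to its right repeat those right of
  -- the midpoint of w_{4k+2}.
  have hcent : ∀ t < h, up (len (4 * k + 5) - h + t) = up (h + t) := fun t ht => by
    rw [hB.eq_not (len (4 * k + 5) - h + t) (h - 1 - t) (by omega) (by omega) (by omega),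
      hC.eq_not (h - 1 - t) (h + t) (by omega) (by omega) (by omega), Bool.not_not]
  have ho := P.lists_succ (fun m h1 h2 hm => by
    rw [hd] at hm
    simp only [add_assoc, Nat.reduceAdd] at h2
    obtain ⟨hq, hcompl⟩ := hN.center hm h2.le
    have hqb : 2 * m - len (4 * k + 6) = len (4 * k + 5) := by
      refine hnext _ (by omega) ?_ hq
      by_contra hgt
      have := len_succ_le (4 * k + 5) _ (by rw [hd]; exact hq) (not_le.1 hgt)
      simp only [add_assoc, Nat.reduceAdd] at this
      omega
    -- The central window is the complement of w_{4k+5}. The second letter right of the midpoint is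
    -- 0 both in w_{4k+5} and in w_{4k+6}, which is contradictory.
    have e := hcompl (len (4 * k + 4) + 2) (by omega)
    rw [show len (4 * k + 6) - m + (len (4 * k + 4) + 2) = len (4 * k + 5) - h + 1 by omega,
      hcent 1 (by omega), hu', hB.eq_not (len (4 * k + 4) + 2) (len (4 * k + 4) - 1) (by omega)
        (by omega) (by omega), hA.eq _ 0 (by omega) (by omega) (by omega), up_zero] at e
    simp at e)
  refine ⟨ho.1, ho.2, fun j hj => P.one j (by omega), fun j hj => ?_,
    fun j hj => P.three j (by omega), fun j hj => P.four j (by omega),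
    fun j hj => P.even j (by omega), fun j hj => ?_⟩
  · rcases Nat.lt_or_ge j k with h | h
    · exact P.two j (by omega)
    · obtain rfl : j = k := by omega
      omega
  · rcases Nat.lt_or_ge j (k + 1) with hj' | hj'
    · exact P.center j (by omega)
    · obtain rfl : j = k + 1 := by omega
      have e0 := hcent 0 (by omega)
      have e1 := hcent 1 (by omega)
      refine ⟨len (4 * k + 5) - h, by omega, ?_, by rw [← hu]; exact e0, by rw [e1, hu']⟩
      change len (4 * k + 6) = _
      omega

/-- The longest palindromic suffix of w_{4k+2} 1 is 10101, since w_{4k+2} begins and ends with 1010.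
A longer one would yield a palindromic prefix of length above 3 followed by 0, and only 1 and 101
are followed by 0. -/
theorem succ_two {k : ℕ} (P : PrefixStructure (4 * k + 2)) : PrefixStructure (4 * k + 3) := by
  have hd : decide ((4 * k + 2) % 4 < 2) = false := decide_eq_false (by omega)
  have hC : WinPal up true 0 (len (4 * k + 2)) := winPal_len_two k
  have hN : WinPal up false 0 (len (4 * k + 3)) := winPal_len_three k
  have hc : up (len (4 * k + 2)) = true := up_len _
  have hc4 : 4 ≤ len (4 * k + 2) := by
    have := len_strictMono.monotone (show 2 ≤ 4 * k + 2 by omega)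
    rwa [len_two] at this
  have hc1 : up (len (4 * k + 2) - 1) = false := by
    rw [hC.eq_not _ 0 (by omega) (by omega) (by omega), up_zero]; rfl
  have hc2 : up (len (4 * k + 2) - 2) = true := by
    rw [hC.eq_not _ 1 (by omega) (by omega) (by omega), up_one]; rfl
  have hc3 : up (len (4 * k + 2) - 3) = false := by
    rw [hC.eq_not _ 2 (by omega) (by omega) (by omega), up_two]; rfl
  have hc5 : up (len (4 * k + 2) - 4) = true := by
    rw [hC.eq_not _ 3 (by omega) (by omega) (by omega), up_three]; rfl
  have hl : len (4 * k + 3) = len (4 * k + 2) + 1 + (len (4 * k + 2) - 4) := by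
    refine len_succ_eq (4 * k + 2) _ (by omega) ?_ ?_ <;> rw [hd]
    · have key : ∀ x y, len (4 * k + 2) - 4 ≤ x → x ≤ y →
          x + y = 2 * len (4 * k + 2) - 4 → up x = up y := by
        intro x y hx hxy h
        obtain ⟨rfl, rfl⟩ | ⟨rfl, rfl⟩ | ⟨rfl, rfl⟩ :
            (x = len (4 * k + 2) - 4 ∧ y = len (4 * k + 2)) ∨
            (x = len (4 * k + 2) - 3 ∧ y = len (4 * k + 2) - 1) ∨
            (x = len (4 * k + 2) - 2 ∧ y = len (4 * k + 2) - 2) := by omega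
        · rw [hc5, hc]
        · rw [hc3, hc1]
        · rfl
      intro x y hx hy hxy
      rw [Bool.false_xor]
      rcases le_total x y with h | h
      · exact key x y hx h (by omega)
      · exact (key y x hy h (by omega)).symm
    · intro i hi h
      have hr : WinPal up false 0 (len (4 * k + 2) - 1 - i) := fun x y _ _ hxy => by
        rw [hC.eq_not x (len (4 * k + 2) - 1 - x) (by omega) (by omega) (by omega),
          hC.eq_not y (len (4 * k + 2) - 1 - y) (by omega) (by omega) (by omega),
          h.eq (len (4 * k + 2) - 1 - x) (len (4 * k + 2) - 1 - y)
            (by omega) (by omega) (by omega)]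
        simp
      have hu : up (len (4 * k + 2) - 1 - i) = false := by
        rw [hC.eq_not _ i (by omega) (by omega) (by omega),
          h.eq i (len (4 * k + 2)) (by omega) (by omega) (by omega), hc]
        rfl
      obtain h' | h' | ⟨j, -, hj, -⟩ := P.pal _ (by omega) (by omega) hr
      · omega
      · omega
      · rw [hj, up_len] at hu
        simp at hu
  have ho := P.lists_succ (fun m h1 h2 hm => by
    rw [hd] at hm
    simp only [add_assoc, Nat.reduceAdd] at h2
    obtain ⟨hq, hcompl⟩ := hN.center hm h2.le
    have hqc : 2 * m - len (4 * k + 3) ≤ len (4 * k + 2) := by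
      by_contra hgt
      have := len_succ_le (4 * k + 2) _ (by rw [hd]; exact hq) (not_le.1 hgt)
      simp only [add_assoc, Nat.reduceAdd] at this
      omega
    obtain h' | h' | ⟨i, hi, hqi, hi0, hi'⟩ := P.pal _ hqc (by omega) hq
    · omega
    · omega
    -- The central window has the parity of |w_{4k+3}|, which is odd; this excludes w_{4j}. For
    -- w_{4j+3} the middle letter is 1, as in w_{4k+3}, so the window cannot be its complement.
    rcases hi' with hi' | hi'
    · obtain ⟨j, rfl⟩ : ∃ j, i = 4 * j + 3 := ⟨i / 4, by omega⟩
      have h3 := P.three j (by omega)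
      have e := hcompl (len (4 * j + 2) - 2) (by omega)
      have hj4 : 4 ≤ len (4 * j + 2) := by
        have := len_strictMono.monotone (show 2 ≤ 4 * j + 2 by omega)
        rwa [len_two] at this
      rw [show len (4 * k + 3) - m + (len (4 * j + 2) - 2) = len (4 * k + 2) - 2 by omega, hc2,
        (winPal_len_two j).eq_not (len (4 * j + 2) - 2) 1 (by omega) (by omega) (by omega),
        up_one] at e
      simp at e
    · obtain ⟨j, rfl⟩ : ∃ j, i = 4 * j := ⟨i / 4, by omega⟩
      have := P.even j hi
      omega)
  refine ⟨ho.1, ho.2, fun j hj => P.one j (by omega), fun j hj => P.two j (by omega),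
    fun j hj => ?_, fun j hj => P.four j (by omega),
    fun j hj => P.even j (by omega), fun j hj => P.center j (by omega)⟩
  rcases Nat.lt_or_ge j k with h | h
  · exact P.three j (by omega)
  · obtain rfl : j = k := by omega
    omega

/-- The longest palindromic suffix of w_{4k+3} 1 is 1 w_{4k} 1: a longer one would give a
palindromic prefix followed by 1 strictly between w_{4k} and w_{4k+3}. A pseudopalindromic prefix
between w_{4k+3} and w_{4k+4} is excluded by parity, as |w_{4k+4}| is even and the candidate central
lengths 1, 3, |w_{4k+3}| are odd. -/
theorem succ_three {k : ℕ} (P : PrefixStructure (4 * k + 3)) : PrefixStructure (4 * k + 4) := by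
  have hd : decide ((4 * k + 3) % 4 < 2) = false := decide_eq_false (by omega)
  have hD : WinPal up false 0 (len (4 * k + 3)) := winPal_len_three k
  have hN : WinPal up false 0 (len (4 * k + 4)) := winPal_len_four k
  have hA : WinPal up false 0 (len (4 * k)) := by
    cases k with
    | zero => exact fun x y _ _ h => by simp [len_zero] at h
    | succ k => exact winPal_len_four k
  have ha : up (len (4 * k)) = true := up_len _
  have hdd : up (len (4 * k + 3)) = true := up_len _
  have hlt : len (4 * k) + 2 < len (4 * k + 3) := by
    have h1 := len_lt_succ (4 * k)
    have h2 := len_lt_succ (4 * k + 1)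
    have h3 := len_lt_succ (4 * k + 2)
    simp only [add_assoc, Nat.reduceAdd] at h1 h2 h3
    omega
  have hnext : ∀ r, len (4 * k) < r → r ≤ len (4 * k + 3) → WinPal up false 0 r →
      r = 1 ∨ r = 3 ∨ r = len (4 * k + 3) := by
    intro r h1 h2 h
    obtain h' | h' | ⟨i, hi, rfl, hi'⟩ := P.pal r h2 (by omega) h
    · exact .inl h'
    · exact .inr (.inl h')
    have := len_strictMono.lt_iff_lt.1 h1
    obtain rfl : i = 4 * k + 3 := by omega
    exact .inr (.inr rfl)
  have hl : len (4 * k + 4) = len (4 * k + 3) + 1 + (len (4 * k + 3) - len (4 * k) - 1) := by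
    refine len_succ_eq (4 * k + 3) _ (by omega) ?_ ?_ <;> rw [hd]
    · have inner : ∀ x, len (4 * k + 3) - len (4 * k) ≤ x → x < len (4 * k + 3) →
          up x = up (x - (len (4 * k + 3) - len (4 * k))) := fun x h1 h2 => by
        rw [hD.eq x (len (4 * k + 3) - 1 - x) (by omega) (by omega) (by omega),
          hA.eq (len (4 * k + 3) - 1 - x) (x - (len (4 * k + 3) - len (4 * k)))
            (by omega) (by omega) (by omega)]
      have hleft : up (len (4 * k + 3) - len (4 * k) - 1) = true := by
        rw [hD.eq _ (len (4 * k)) (by omega) (by omega) (by omega), ha]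
      intro x y hx hy hxy
      rw [Bool.false_xor]
      rcases Nat.lt_or_ge x (len (4 * k + 3) - len (4 * k)) with h | h
      · obtain rfl : x = len (4 * k + 3) - len (4 * k) - 1 := by omega
        obtain rfl : y = len (4 * k + 3) := by omega
        rw [hleft, hdd]
      rcases Nat.lt_or_ge y (len (4 * k + 3) - len (4 * k)) with h' | h'
      · obtain rfl : y = len (4 * k + 3) - len (4 * k) - 1 := by omega
        obtain rfl : x = len (4 * k + 3) := by omega
        rw [hleft, hdd]
      rw [inner x h (by omega), inner y h' (by omega)]
      exact hA.eq _ _ (by omega) (by omega) (by omega)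
    · intro i hi h
      have hr : WinPal up false 0 (len (4 * k + 3) - 1 - i) := fun x y _ _ hxy => by
        rw [hD.eq x (len (4 * k + 3) - 1 - x) (by omega) (by omega) (by omega),
          hD.eq y (len (4 * k + 3) - 1 - y) (by omega) (by omega) (by omega),
          h.eq (len (4 * k + 3) - 1 - x) (len (4 * k + 3) - 1 - y)
            (by omega) (by omega) (by omega)]
        simp
      have hu : up (len (4 * k + 3) - 1 - i) = true := by
        rw [hD.eq _ i (by omega) (by omega) (by omega),
          h.eq i (len (4 * k + 3)) (by omega) (by omega) (by omega), hdd]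
      obtain h' | h' | h' := hnext _ (by omega) (by omega) hr
      · rw [h', up_one] at hu
        simp at hu
      · rw [h', up_three] at hu
        simp at hu
      · omega
  have h3 := P.three k (by omega)
  have heven := P.even k (by omega)
  have ho := P.lists_succ (fun m h1 h2 hm => by
    rw [hd] at hm
    simp only [add_assoc, Nat.reduceAdd] at h2
    obtain ⟨hq, -⟩ := hN.center hm h2.le
    have hqd : 2 * m - len (4 * k + 4) ≤ len (4 * k + 3) := by
      by_contra hgt
      have := len_succ_le (4 * k + 3) _ (by rw [hd]; exact hq) (not_le.1 hgt)
      simp only [add_assoc, Nat.reduceAdd] at this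
      omega
    obtain h' | h' | h' := hnext _ (by omega) hqd hq <;> omega)
  refine ⟨ho.1, ho.2, fun j hj => P.one j (by omega), fun j hj => P.two j (by omega),
    fun j hj => P.three j (by omega), fun j hj => ?_,
    fun j hj => ?_, fun j hj => P.center j (by omega)⟩
  · rcases Nat.lt_or_ge j k with h | h
    · exact P.four j (by omega)
    · obtain rfl : j = k := by omega
      omega
  · rcases Nat.lt_or_ge j (k + 1) with h | h
    · exact P.even j (by omega)
    · obtain rfl : j = k + 1 := by omega
      change len (4 * k + 4) % 2 = 0
      omega

end PrefixStructure

theorem prefixStructure (n : ℕ) (hn : 3 ≤ n) : PrefixStructure n := by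
  induction n, hn using Nat.le_induction with
  | base => exact prefixStructure_three
  | succ n hn P =>
    have hmod : n % 4 = 0 ∨ n % 4 = 1 ∨ n % 4 = 2 ∨ n % 4 = 3 := by omega
    rcases hmod with h | h | h | h
    · obtain ⟨k, rfl⟩ : ∃ k, n = 4 * k := ⟨n / 4, by omega⟩
      exact P.succ_zero (by omega)
    · obtain ⟨k, rfl⟩ : ∃ k, n = 4 * k + 5 := ⟨n / 4 - 1, by omega⟩
      exact P.succ_one
    · obtain ⟨k, rfl⟩ : ∃ k, n = 4 * k + 2 := ⟨n / 4, by omega⟩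
      exact P.succ_two
    · obtain ⟨k, rfl⟩ : ∃ k, n = 4 * k + 3 := ⟨n / 4, by omega⟩
      exact P.succ_three

theorem len_four_mul_add_one (k : ℕ) : len (4 * k + 1) = 2 * len (4 * k) + 2 :=
  (prefixStructure (4 * k + 3) (by omega)).one k (by omega)

theorem len_four_mul_add_six (k : ℕ) :
    len (4 * k + 6) + len (4 * k + 2) = 2 * len (4 * k + 5) :=
  (prefixStructure (4 * k + 6) (by omega)).two k le_rfl

theorem len_four_mul_add_three (k : ℕ) : len (4 * k + 3) + 3 = 2 * len (4 * k + 2) :=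
  (prefixStructure (4 * k + 3) (by omega)).three k le_rfl

theorem len_four_mul_add_four (k : ℕ) :
    len (4 * k + 4) + len (4 * k) = 2 * len (4 * k + 3) :=
  (prefixStructure (4 * k + 4) (by omega)).four k le_rfl


/-! ### Left special factors and branches -/

/-- Every factor of `up` is mapped to a factor by both antimorphisms. -/
theorem exists_reversed_window (e : Bool) (i n : ℕ) :
    ∃ i', ∀ j < n, up (i' + j) = (e ^^ up (i + (n - 1 - j))) := by
  obtain ⟨N, hN, hP⟩ : ∃ N, i + n ≤ N ∧ WinPal up e 0 N := by
    cases e with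
    | false => exact ⟨_, (show i + n ≤ 4 * (i + n) + 4 by omega).trans
        len_strictMono.le_apply, winPal_len_four (i + n)⟩
    | true => exact ⟨_, (show i + n ≤ 4 * (i + n) + 1 by omega).trans
        len_strictMono.le_apply, winPal_len_one (i + n)⟩
  exact ⟨N - i - n, fun j hj => hP _ _ (by omega) (by omega) (by omega)⟩

theorem exists_complement_window (i n : ℕ) : ∃ i', ∀ j < n, up (i' + j) = !up (i + j) := by
  obtain ⟨i₁, h₁⟩ := exists_reversed_window false i n
  obtain ⟨i₂, h₂⟩ := exists_reversed_window true i₁ n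
  refine ⟨i₂, fun j hj => ?_⟩
  rw [h₂ j hj, h₁ _ (by omega), show n - 1 - (n - 1 - j) = j by omega]
  simp

/-- The word `f 0 ⋯ f (n - 1)` can be extended to the left by both letters inside `up`. -/
def LeftSpecial (f : ℕ → Bool) (n : ℕ) : Prop :=
  ∀ b, ∃ i, up i = b ∧ ∀ j < n, up (i + 1 + j) = f j

theorem LeftSpecial.mono {f : ℕ → Bool} {m n : ℕ} (h : LeftSpecial f n) (hmn : m ≤ n) :
    LeftSpecial f m := fun b => by
  obtain ⟨i, h0, hi⟩ := h b
  exact ⟨i, h0, fun j hj => hi j (by omega)⟩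

theorem LeftSpecial.not {f : ℕ → Bool} {n : ℕ} (h : LeftSpecial f n) :
    LeftSpecial (fun j => !f j) n := fun b => by
  obtain ⟨i, h0, hi⟩ := h (!b)
  obtain ⟨i', hi'⟩ := exists_complement_window i (n + 1)
  refine ⟨i', ?_, fun j hj => ?_⟩
  · have := hi' 0 (by omega)
    simpa [h0] using this
  · have := hi' (1 + j) (by omega)
    rw [← add_assoc, ← add_assoc, hi j hj] at this
    exact this

/-- For a ϑ-palindromic window v, the complement of v is also its image under the other
antimorphism. Complementing v with its left neighbour and applying that antimorphism to v with its
right neighbour give two left extensions of the complement; `ha` says that they differ. -/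
theorem leftSpecial_of_winPal {e : Bool} {s L : ℕ} (h : WinPal up e (s + 1) (s + 1 + L))
    (ha : up s = !(e ^^ up (s + 1 + L))) : LeftSpecial (fun j => !up (s + 1 + j)) L := by
  intro b
  by_cases hb : b = !up s
  · obtain ⟨i, hi⟩ := exists_complement_window s (L + 1)
    refine ⟨i, hb ▸ hi 0 (by omega), fun j hj => ?_⟩
    change _ = !up (s + 1 + j)
    rw [add_assoc, add_assoc]
    exact hi (1 + j) (by omega)
  · obtain ⟨i, hi⟩ := exists_reversed_window (!e) (s + 1) (L + 1)
    have hb' : b = up s := by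
      revert hb; cases b <;> cases up s <;> simp
    refine ⟨i, ?_, fun j hj => ?_⟩
    · have := hi 0 (by omega)
      rw [Nat.add_zero, Nat.add_sub_cancel, Nat.sub_zero] at this
      rw [this, hb', ha]
      cases e <;> simp
    · change _ = !up (s + 1 + j)
      rw [add_assoc, hi (1 + j) (by omega), h (s + 1 + j) (s + 1 + (L + 1 - 1 - (1 + j)))
        (by omega) (by omega) (by omega)]
      cases e <;> simp

theorem winPal_len_zero (k : ℕ) : WinPal up false 0 (len (4 * k)) := by
  cases k with
  | zero => exact fun x y _ _ h => by simp [len_zero] at h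
  | succ k => exact winPal_len_four k

theorem leftSpecial_up (n : ℕ) : LeftSpecial up n := by
  suffices h : ∀ k, LeftSpecial up (len (4 * k)) from
    (h n).mono ((show n ≤ 4 * n by omega).trans len_strictMono.le_apply)
  intro k b
  have hA := winPal_len_zero k
  have hB := winPal_len_one k
  have hab := len_four_mul_add_one k
  have ha := up_len (4 * k)
  have hb := up_len (4 * k + 1)
  have hA' : ∀ y < len (4 * k), up (len (4 * k) + 2 + y) = !up y := fun y hy => by
    rw [hB.eq_not (len (4 * k) + 2 + y) (len (4 * k) - 1 - y) (by omega) (by omega) (by omega),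
      hA.eq (len (4 * k) - 1 - y) y (by omega) (by omega) (by omega)]
  cases b with
  | false =>
    obtain ⟨i, hi⟩ := exists_reversed_window true (len (4 * k) + 2) (len (4 * k) + 1)
    refine ⟨i, ?_, fun j hj => ?_⟩
    · have := hi 0 (by omega)
      rw [show len (4 * k) + 2 + (len (4 * k) + 1 - 1 - 0) = len (4 * k + 1) by omega, hb] at this
      exact this
    · rw [add_assoc, hi _ (by omega), hA' _ (by omega),
        hA.eq _ j (by omega) (by omega) (by omega)]
      simp
  | true =>
    obtain ⟨i, hi⟩ := exists_reversed_window false 0 (len (4 * k) + 1)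
    refine ⟨i, ?_, fun j hj => ?_⟩
    · have := hi 0 (by omega)
      simpa [ha] using this
    · rw [add_assoc, hi _ (by omega), hA.eq _ j (by omega) (by omega) (by omega)]
      simp

/-- The palindromic window starts with the last |w_{4k+1}| letters of w_{4k+3}, which form the
complement of w_{4k+1}, and runs past the end of w_{4k+4}. Its complement leaves `up` where w_{4k+3}
ends, because both w_{4k+1} and w_{4k+3} are followed by 1. -/
theorem exists_branch_one (k : ℕ) : ∃ f : ℕ → Bool, (∀ j < len (4 * k + 1), f j = up j) ∧
    f (len (4 * k + 1)) ≠ up (len (4 * k + 1)) ∧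
    LeftSpecial f (len (4 * k + 1) + len (4 * k + 3) + 2) := by
  have hA := winPal_len_zero k
  have hB := winPal_len_one k
  have hD := winPal_len_three k
  have hA' := winPal_len_four k
  have hB' : WinPal up true 0 (len (4 * k + 5)) := winPal_len_one (k + 1)
  have hab := len_four_mul_add_one k
  have hab' : len (4 * k + 5) = 2 * len (4 * k + 4) + 2 := len_four_mul_add_one (k + 1)
  have had := len_four_mul_add_four k
  have h1 := len_lt_succ (4 * k + 1)
  have h2 := len_lt_succ (4 * k + 2)
  have h3 := len_lt_succ (4 * k + 3)
  simp only [add_assoc, Nat.reduceAdd] at h1 h2 h3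
  have ua := up_len (4 * k)
  have ub := up_len (4 * k + 1)
  have ud := up_len (4 * k + 3)
  have ua' := up_len (4 * k + 4)
  generalize len (4 * k) = a at *
  generalize len (4 * k + 1) = b at *
  generalize len (4 * k + 2) = c at *
  generalize len (4 * k + 3) = d at *
  generalize len (4 * k + 4) = a' at *
  generalize len (4 * k + 5) = b' at *
  obtain ⟨s, hs⟩ : ∃ s, d = b + 1 + s := ⟨d - b - 1, by omega⟩
  refine ⟨fun j => !up (s + 1 + j), fun j hj => ?_, ?_, ?_⟩
  · simp only
    rw [hD.eq (s + 1 + j) (b - 1 - j) (by omega) (by omega) (by omega),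
      hB.eq_not (b - 1 - j) j (by omega) (by omega) (by omega), Bool.not_not]
  · simp only
    rw [show s + 1 + b = d by omega, ud, ub]
    simp
  -- What follows w_{4k+4} looks like what follows w_{4k}, while w_{4k+4} itself is two overlapping
  -- copies of w_{4k+3} (`copy`). Both facts turn reflection in the window into reflection in
  -- w_{4k+3}.
  have tail : ∀ t ≤ a + 1, up (a' + t) = up (a + t) := by
    intro t ht
    obtain rfl | rfl | ht2 : t = 0 ∨ t = 1 ∨ 2 ≤ t := by omega
    · rw [Nat.add_zero, Nat.add_zero, ua, ua']
    · rw [hB'.eq_not (a' + 1) a' (by omega) (by omega) (by omega),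
        hB.eq_not (a + 1) a (by omega) (by omega) (by omega), ua, ua']
    · rw [hB'.eq_not (a' + t) (a' + 1 - t) (by omega) (by omega) (by omega),
        hA'.eq (a' + 1 - t) (t - 2) (by omega) (by omega) (by omega),
        hB.eq_not (a + t) (a + 1 - t) (by omega) (by omega) (by omega),
        hA.eq (a + 1 - t) (t - 2) (by omega) (by omega) (by omega)]
  have copy : ∀ x, d ≤ x + a → x + a < 2 * d → up x = up (x + a - d) := by
    intro x h1 h2
    rw [hA'.eq x (a' - 1 - x) (by omega) (by omega) (by omega),
      hD.eq (a' - 1 - x) (x + a - d) (by omega) (by omega) (by omega)]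
  have half : ∀ x y, s + 1 ≤ x → x ≤ y → x + y + b = 3 * d + 1 → up x = up y := by
    intro x y hx hxy h
    rcases Nat.lt_or_ge (x + a) d with hlt | hge
    · rw [show y = a' + (y - a') by omega, tail _ (by omega)]
      exact hD.eq _ _ (by omega) (by omega) (by omega)
    · rw [copy x hge (by omega), copy y (by omega) (by omega)]
      exact hD.eq _ _ (by omega) (by omega) (by omega)
  refine leftSpecial_of_winPal (e := false) (fun x y hx hy hxy => ?_) ?_
  · rw [Bool.false_xor]
    rcases le_total x y with h | h
    · exact half x y hx h (by omega)
    · exact (half y x hy h (by omega)).symm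
  · rw [show s + 1 + (b + d + 2) = a' + (a + 2) by omega,
      hB'.eq_not (a' + (a + 2)) (a' - 1 - a) (by omega) (by omega) (by omega),
      hA'.eq (a' - 1 - a) a (by omega) (by omega) (by omega), ua,
      hD.eq s b (by omega) (by omega) (by omega), ub]
    simp

/-- The same construction with the types exchanged: the pseudopalindromic window starts with the
last |w_{4k+3}| letters of w_{4k+5} and runs past the end of w_{4k+6}. It is shorter by 5 relative
to the other case because |w_{4k+3}| = 2|w_{4k+2}| - 3. -/
theorem exists_branch_three (k : ℕ) : ∃ f : ℕ → Bool, (∀ j < len (4 * k + 3), f j = up j) ∧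
    f (len (4 * k + 3)) ≠ up (len (4 * k + 3)) ∧
    LeftSpecial f (len (4 * k + 3) + len (4 * k + 5) - 3) := by
  have hC := winPal_len_two k
  have hD := winPal_len_three k
  have hB' : WinPal up true 0 (len (4 * k + 5)) := winPal_len_one (k + 1)
  have hC' : WinPal up true 0 (len (4 * k + 6)) := winPal_len_two (k + 1)
  have hD' : WinPal up false 0 (len (4 * k + 7)) := winPal_len_three (k + 1)
  have hcd := len_four_mul_add_three k
  have hcd' : len (4 * k + 7) + 3 = 2 * len (4 * k + 6) := len_four_mul_add_three (k + 1)
  have hbc := len_four_mul_add_six k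
  have h0 := len_strictMono.monotone (show 2 ≤ 4 * k + 2 by omega)
  rw [len_two] at h0
  have h2 := len_lt_succ (4 * k + 2)
  have h3 := len_lt_succ (4 * k + 3)
  have h4 := len_lt_succ (4 * k + 4)
  have h5 := len_lt_succ (4 * k + 5)
  simp only [add_assoc, Nat.reduceAdd] at h2 h3 h4 h5
  have uc := up_len (4 * k + 2)
  have ud := up_len (4 * k + 3)
  have ub' := up_len (4 * k + 5)
  generalize len (4 * k + 2) = c at *
  generalize len (4 * k + 3) = d at *
  generalize len (4 * k + 4) = a' at *
  generalize len (4 * k + 5) = b' at *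
  generalize len (4 * k + 6) = c' at *
  generalize len (4 * k + 7) = d' at *
  obtain ⟨s, hs⟩ : ∃ s, b' = d + 1 + s := ⟨b' - d - 1, by omega⟩
  refine ⟨fun j => !up (s + 1 + j), fun j hj => ?_, ?_, ?_⟩
  · simp only
    rw [hB'.eq_not (s + 1 + j) (d - 1 - j) (by omega) (by omega) (by omega),
      hD.eq (d - 1 - j) j (by omega) (by omega) (by omega), Bool.not_not]
  · simp only
    rw [show s + 1 + d = b' by omega, ud, ub']
    simp
  have tail : ∀ t, t + 4 ≤ c → up (c' + t) = up (c + t) := by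
    intro t ht
    rw [hD'.eq (c' + t) (c' - 4 - t) (by omega) (by omega) (by omega),
      hC'.eq_not (c' - 4 - t) (t + 3) (by omega) (by omega) (by omega),
      hD.eq (c + t) (c - 4 - t) (by omega) (by omega) (by omega),
      hC.eq_not (c - 4 - t) (t + 3) (by omega) (by omega) (by omega)]
  have copy : ∀ x, b' ≤ x + c → x + c < 2 * b' → up x = up (x + c - b') := by
    intro x h1 h2
    rw [hC'.eq_not x (c' - 1 - x) (by omega) (by omega) (by omega),
      hB'.eq_not (c' - 1 - x) (x + c - b') (by omega) (by omega) (by omega), Bool.not_not]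
  have half : ∀ x y, s + 1 ≤ x → x ≤ y → x + y + d + 4 = 3 * b' → up x = !up y := by
    intro x y hx hxy h
    rcases Nat.lt_or_ge (x + c) b' with hlt | hge
    · rw [show y = c' + (y - c') by omega, tail _ (by omega)]
      exact hB'.eq_not _ _ (by omega) (by omega) (by omega)
    · rw [copy x hge (by omega), copy y (by omega) (by omega)]
      exact hB'.eq_not _ _ (by omega) (by omega) (by omega)
  refine leftSpecial_of_winPal (e := true) (fun x y hx hy hxy => ?_) ?_
  · rw [Bool.true_xor]
    rcases le_total x y with h | h
    · exact half x y hx h (by omega)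
    · rw [half y x hy h (by omega), Bool.not_not]
  · rw [show s + 1 + (d + b' - 3) = c' + (c - 3) by omega,
      hD'.eq (c' + (c - 3)) (c' - 1 - c) (by omega) (by omega) (by omega),
      hC'.eq_not (c' - 1 - c) c (by omega) (by omega) (by omega), uc,
      hB'.eq_not s d (by omega) (by omega) (by omega), ud]
    simp

/-- The left special factors that leave the prefixes of `up` at length `|w_{2p+1}|`. -/
theorem exists_branch (p : ℕ) : ∃ f : ℕ → Bool, (∀ j < len (2 * p + 1), f j = up j) ∧
    f (len (2 * p + 1)) ≠ up (len (2 * p + 1)) ∧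
    LeftSpecial f (len (2 * p + 1) + len (2 * p + 3) - 3) := by
  obtain ⟨k, rfl⟩ | ⟨k, rfl⟩ : (∃ k, p = 2 * k) ∨ ∃ k, p = 2 * k + 1 := by
    rcases Nat.even_or_odd' p with ⟨k, h | h⟩
    · exact .inl ⟨k, h⟩
    · exact .inr ⟨k, h⟩
  · obtain ⟨f, h1, h2, h3⟩ := exists_branch_one k
    rw [show 2 * (2 * k) = 4 * k by ring]
    exact ⟨f, h1, h2, h3.mono (by omega)⟩
  · rw [show 2 * (2 * k + 1) + 1 = 4 * k + 3 by ring, show 2 * (2 * k + 1) + 3 = 4 * k + 5 by ring]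
    exact exists_branch_three k


/-! ### From left special factors to a lower bound for the complexity -/

/-- The word `f 0 ⋯ f (n - 1)`. -/
def initWord (f : ℕ → Bool) (n : ℕ) : Word := (List.range n).map f

theorem length_initWord (f : ℕ → Bool) (n : ℕ) : (initWord f n).length = n := by
  simp [initWord]

theorem initWord_inj {f g : ℕ → Bool} {n : ℕ} (h : initWord f n = initWord g n) {j : ℕ}
    (hj : j < n) : f j = g j :=
  List.map_inj_left.1 h j (List.mem_range.2 hj)

theorem LeftSpecial.isFactor_cons {f : ℕ → Bool} {n : ℕ} (h : LeftSpecial f n) (b : Bool) :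
    IsFactor up (b :: initWord f n) := by
  obtain ⟨i, h0, hi⟩ := h b
  refine ⟨i, ?_⟩
  rw [List.length_cons, length_initWord, List.range_succ_eq_map, List.map_cons, Nat.add_zero, h0,
    List.map_map]
  congr 1
  refine List.map_congr_left fun j hj => ?_
  rw [← hi j (List.mem_range.1 hj), Function.comp_apply, Nat.succ_eq_add_one, add_comm j,
    add_assoc]

theorem IsFactor.exists_cons {w : Word} (h : IsFactor up w) : ∃ b, IsFactor up (b :: w) := by
  obtain ⟨i, hi⟩ := h
  obtain ⟨i₁, h₁⟩ := exists_reversed_window false i w.length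
  obtain ⟨i₂, h₂⟩ := exists_reversed_window false i₁ (w.length + 1)
  refine ⟨up i₂, i₂, ?_⟩
  rw [List.length_cons, List.range_succ_eq_map, List.map_cons, List.map_map, Nat.add_zero]
  congr 1
  conv_lhs => rw [hi]
  refine List.map_congr_left fun j hj => ?_
  have hj' := List.mem_range.1 hj
  rw [Function.comp_apply, Nat.succ_eq_add_one, h₂ _ (by omega),
    show w.length + 1 - 1 - (j + 1) = w.length - 1 - j by omega, h₁ _ (by omega),
    show w.length - 1 - (w.length - 1 - j) = j by omega]
  simp

/-- Choosing one left extension of each factor is injective, and each left special word supplies a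
second extension not yet counted. -/
theorem complexity_succ_ge (n : ℕ) (S : Finset Word)
    (hS : ∀ w ∈ S, w.length = n ∧ ∀ b, IsFactor up (b :: w)) :
    complexity up n + S.card ≤ complexity up (n + 1) := by
  classical
  choose! b hb using fun w : Word => IsFactor.exists_cons (w := w)
  let F : Set Word := {w | w.length = n ∧ IsFactor up w}
  have hsub : (fun w => b w :: w) '' F ∪ (fun w => (!b w) :: w) '' (S : Set Word) ⊆
      {w : Word | w.length = n + 1 ∧ IsFactor up w} := by
    rintro _ (⟨w, hw, rfl⟩ | ⟨w, hw, rfl⟩)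
    · exact ⟨by simp [hw.1], hb w hw.2⟩
    · exact ⟨by simp [(hS w hw).1], (hS w hw).2 _⟩
  have hdisj : Disjoint ((fun w => b w :: w) '' F) ((fun w => (!b w) :: w) '' (S : Set Word)) := by
    rw [Set.disjoint_left]
    rintro _ ⟨w, hw, rfl⟩ ⟨v, hv, hvw⟩
    simp only [List.cons.injEq] at hvw
    obtain ⟨h1, rfl⟩ := hvw
    simp at h1
  have hle := Set.ncard_le_ncard hsub (finite_factors up (n + 1))
  rw [Set.ncard_union_eq hdisj ((finite_factors up n).image _) (S.finite_toSet.image _),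
    Set.ncard_image_of_injective _ (fun x y h => (List.cons.inj h).2),
    Set.ncard_image_of_injective _ (fun x y h => (List.cons.inj h).2),
    Set.ncard_coe_finset] at hle
  exact hle

theorem complexity_succ_ge_branches (m n : ℕ) (hn : 1 ≤ n) :
    complexity up n + 2 + 2 * ((Finset.range m).filter fun p =>
        len (2 * p + 1) < n ∧ n ≤ len (2 * p + 1) + len (2 * p + 3) - 3).card ≤
      complexity up (n + 1) := by
  classical
  choose f hf hne hls using exists_branch
  set A := (Finset.range m).filter fun p =>
        len (2 * p + 1) < n ∧ n ≤ len (2 * p + 1) + len (2 * p + 3) - 3 with hA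
  let g : Option ℕ → ℕ → Bool := fun o => o.elim up f
  have hg0 : ∀ o, g o 0 = up 0 := by
    rintro (_ | p)
    · rfl
    · exact hf p 0 (by have := len_lt_succ (2 * p); omega)
  let W : Option ℕ × Bool → Word := fun x => initWord (fun j => x.2 ^^ g x.1 j) n
  let I : Finset (Option ℕ × Bool) := Finset.insertNone A ×ˢ Finset.univ
  have hmem : ∀ p, some p ∈ Finset.insertNone A → p ∈ A := fun p hp => by simpa using hp
  have hlen : ∀ p ∈ A, len (2 * p + 1) < n := fun p hp => (Finset.mem_filter.1 hp).2.1
  have hspec : ∀ x ∈ I, LeftSpecial (fun j => x.2 ^^ g x.1 j) n := by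
    rintro ⟨o, b⟩ hx
    have ho := (Finset.mem_product.1 hx).1
    have : LeftSpecial (g o) n := by
      rcases o with _ | p
      · exact leftSpecial_up n
      · exact (hls p).mono (Finset.mem_filter.1 (hmem p ho)).2.2
    cases b with
    | false => simpa using this
    | true => simpa using this.not
  -- The letter at position |w_{2p+1}| separates branch p from `up` and from every later branch.
  -- Complements are separated from all of these by the initial letter.
  have hlt : ∀ p ∈ A, ∀ o ∈ Finset.insertNone A, (∀ q, o = some q → p < q) →
      ¬ ∀ j < n, g (some p) j = g o j := by
    intro p hp o ho hq h
    have h1 := h _ (hlen p hp)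
    refine hne p (h1.trans ?_)
    rcases o with _ | q
    · rfl
    · exact hf q _ (len_strictMono (by have := hq q rfl; omega))
  have hinj : Set.InjOn W I := by
    rintro ⟨o, b⟩ hx ⟨o', b'⟩ hx' h
    have ho := (Finset.mem_product.1 hx).1
    have ho' := (Finset.mem_product.1 hx').1
    have hb : b = b' := by
      have := initWord_inj h (show 0 < n by omega)
      simp only [hg0] at this
      exact (Bool.xor_left_inj).1 this
    subst hb
    have hgg : ∀ j < n, g o j = g o' j := fun j hj => by
      have := initWord_inj h hj
      exact (Bool.xor_right_inj).1 this
    have hgg' : ∀ j < n, g o' j = g o j := fun j hj => (hgg j hj).symm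
    have hoo : o = o' := by
      rcases o with _ | p <;> rcases o' with _ | q
      · rfl
      · exact absurd hgg' (hlt q (hmem q ho') none ho (by simp))
      · exact absurd hgg (hlt p (hmem p ho) none ho' (by simp))
      · rcases lt_trichotomy p q with hpq | rfl | hpq
        · exact absurd hgg (hlt p (hmem p ho) (some q) ho' (by simpa using hpq))
        · rfl
        · exact absurd hgg' (hlt q (hmem q ho') (some p) ho (by simpa using hpq))
    rw [hoo]
  have hcard : (I.image W).card = 2 + 2 * A.card := by
    rw [Finset.card_image_of_injOn hinj, Finset.card_product, Finset.card_insertNone]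
    simp
    ring
  have := complexity_succ_ge n (I.image W)
    (fun w hw => by
      obtain ⟨x, hx, rfl⟩ := Finset.mem_image.1 hw
      exact ⟨length_initWord _ _, (hspec x hx).isFactor_cons⟩)
  rw [hcard] at this
  omega

/-- Summing the increments: the truncated difference counts the lengths below n at which branch p is
active. The slack 2 makes the bound trivial for n ≤ 1, where no branch is active. -/
theorem complexity_ge (m n : ℕ) :
    2 * n + 2 * ∑ p ∈ Finset.range m,
      (min n (len (2 * p + 1) + len (2 * p + 3) - 2) - (len (2 * p + 1) + 1)) ≤
      complexity up n + 2 := by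
  induction n with
  | zero => simp
  | succ n ih =>
    rcases Nat.eq_zero_or_pos n with rfl | hn
    · have : ∀ p ∈ Finset.range m,
          (min (0 + 1) (len (2 * p + 1) + len (2 * p + 3) - 2) - (len (2 * p + 1) + 1)) = 0 :=
        fun p _ => by omega
      rw [Finset.sum_eq_zero this]
      omega
    · have h := complexity_succ_ge_branches m n hn
      rw [Finset.card_filter] at h
      have hsum : ∑ p ∈ Finset.range m,
          (min (n + 1) (len (2 * p + 1) + len (2 * p + 3) - 2) - (len (2 * p + 1) + 1)) ≤
          ∑ p ∈ Finset.range m,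
            (min n (len (2 * p + 1) + len (2 * p + 3) - 2) - (len (2 * p + 1) + 1)) +
          ∑ p ∈ Finset.range m,
            if len (2 * p + 1) < n ∧ n ≤ len (2 * p + 1) + len (2 * p + 3) - 3 then 1 else 0 := by
        rw [← Finset.sum_add_distrib]
        refine Finset.sum_le_sum fun p _ => ?_
        split_ifs with hc <;> omega
      omega


/-! ### Asymptotics of the lengths -/

/-- The length of `w_{2p+1}` as a real number. -/
noncomputable def oddLen (p : ℕ) : ℝ := len (2 * p + 1)

theorem oddLen_recurrence (p : ℕ) :
    4 * oddLen (p + 1) - 6 ≤ oddLen (p + 2) + oddLen p ∧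
      oddLen (p + 2) + oddLen p ≤ 4 * oddLen (p + 1) + 4 := by
  have key : 4 * len (2 * p + 3) ≤ len (2 * p + 5) + len (2 * p + 1) + 6 ∧
      len (2 * p + 5) + len (2 * p + 1) ≤ 4 * len (2 * p + 3) + 4 := by
    obtain ⟨k, rfl | rfl⟩ := Nat.even_or_odd' p
    · have h1 := len_four_mul_add_one k
      have h2 : len (4 * k + 5) = 2 * len (4 * k + 4) + 2 := len_four_mul_add_one (k + 1)
      have h3 := len_four_mul_add_four k
      rw [show 2 * (2 * k) = 4 * k by ring]
      omega
    · have h1 := len_four_mul_add_three k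
      have h2 : len (4 * k + 7) + 3 = 2 * len (4 * k + 6) := len_four_mul_add_three (k + 1)
      have h3 := len_four_mul_add_six k
      rw [show 2 * (2 * k + 1) + 1 = 4 * k + 3 by ring,
        show 2 * (2 * k + 1) + 3 = 4 * k + 5 by ring, show 2 * (2 * k + 1) + 5 = 4 * k + 7 by ring]
      omega
  unfold oddLen
  rw [show 2 * (p + 1) + 1 = 2 * p + 3 by ring, show 2 * (p + 2) + 1 = 2 * p + 5 by ring]
  constructor
  · have : (4 * len (2 * p + 3) : ℝ) ≤ len (2 * p + 5) + len (2 * p + 1) + 6 := by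
      exact_mod_cast key.1
    linarith
  · exact_mod_cast key.2

theorem sqrt_three_bounds : 1.7320508 < √3 ∧ √3 < 1.7320509 :=
  ⟨Real.lt_sqrt_of_sq_lt (by norm_num), (Real.sqrt_lt' (by norm_num)).2 (by norm_num)⟩

/-- The defect from ratio 2 + √3 is multiplied at each step by the conjugate root 2 - √3 < 1, up to
an error in [-6, 4]. The bound 20 is a convenient invariant, not an optimal one. -/
theorem oddLen_succ_bounds (p : ℕ) :
    -20 ≤ oddLen (p + 1) - (2 + √3) * oddLen p ∧
      oddLen (p + 1) - (2 + √3) * oddLen p ≤ 20 := by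
  obtain ⟨hs1, hs2⟩ := sqrt_three_bounds
  have hsq : √3 * √3 = 3 := Real.mul_self_sqrt (by norm_num)
  induction p with
  | zero =>
    simp only [oddLen, zero_add, mul_zero, mul_one, Nat.reduceAdd, len_one, len_three]
    norm_num
    constructor <;> linarith
  | succ p ih =>
    obtain ⟨h1, h2⟩ := oddLen_recurrence p
    have e : (2 - √3) * (oddLen (p + 1) - (2 + √3) * oddLen p) =
        (2 - √3) * oddLen (p + 1) - oddLen p := by
      linear_combination (oddLen p) * hsq
    have h3 : (2 - √3) * (oddLen (p + 1) - (2 + √3) * oddLen p) ≤ (2 - √3) * 20 :=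
      mul_le_mul_of_nonneg_left ih.2 (by linarith)
    have h4 : (2 - √3) * (-20) ≤ (2 - √3) * (oddLen (p + 1) - (2 + √3) * oddLen p) :=
      mul_le_mul_of_nonneg_left ih.1 (by linarith)
    rw [e] at h3 h4
    constructor <;> linarith

/-- Geometric summation with ratio 2 + √3: the factor (√3 - 1)/2 is 1/((2 + √3) - 1), and each step
loses at most a constant. -/
theorem sum_oddLen_ge (m : ℕ) :
    (√3 - 1) / 2 * oddLen m - 20 * (m + 1) ≤ ∑ p ∈ Finset.range m, oddLen p := by
  obtain ⟨hs1, hs2⟩ := sqrt_three_bounds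
  have hsq : √3 * √3 = 3 := Real.mul_self_sqrt (by norm_num)
  induction m with
  | zero =>
    simp only [oddLen, mul_zero, zero_add, len_one, Finset.range_zero, Finset.sum_empty]
    norm_num
    linarith
  | succ m ih =>
    rw [Finset.sum_range_succ]
    have h := mul_le_mul_of_nonneg_left (oddLen_succ_bounds m).2
      (show 0 ≤ (√3 - 1) / 2 by linarith)
    have e : (√3 - 1) / 2 * (oddLen (m + 1) - (2 + √3) * oddLen m) =
        (√3 - 1) / 2 * oddLen (m + 1) - (√3 + 1) / 2 * oddLen m := by
      linear_combination (-(oddLen m) / 2) * hsq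
    rw [e] at h
    push_cast
    linarith

/-- The lengths at which the complexity is large compared with the length. -/
def peak (q : ℕ) : ℕ := len (2 * q + 1) + len (2 * q + 3)

theorem complexity_peak_ge (q : ℕ) :
    (4 + √3 / 3) * peak q - 400 * (q + 1) ≤ complexity up (peak q) := by
  obtain ⟨hs1, hs2⟩ := sqrt_three_bounds
  have hsq : √3 * √3 = 3 := Real.mul_self_sqrt (by norm_num)
  have h := complexity_ge (q + 2) (peak q)
  -- At the peak length the branches p ≤ q are complete and contribute x_{p+1} - 3 each; branch q +
  -- 1 is still active and contributes x_q - 1.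
  have hterm : ∀ p ∈ Finset.range (q + 1), len (2 * (p + 1) + 1) ≤
      min (peak q) (len (2 * p + 1) + len (2 * p + 3) - 2) - (len (2 * p + 1) + 1) + 3 := by
    intro p hp
    have hp' := Finset.mem_range.1 hp
    have h1 := len_strictMono.monotone (show 2 * p + 1 ≤ 2 * q + 1 by omega)
    have h2 := len_strictMono.monotone (show 2 * p + 3 ≤ 2 * q + 3 by omega)
    have h3 : len (2 * (p + 1) + 1) = len (2 * p + 3) := rfl
    unfold peak
    omega
  have hlast : len (2 * q + 1) ≤ min (peak q) (len (2 * (q + 1) + 1) + len (2 * (q + 1) + 3) - 2) -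
      (len (2 * (q + 1) + 1) + 1) + 1 := by
    have h1 := len_strictMono (show 2 * q + 1 < 2 * q + 2 by omega)
    have h2 := len_strictMono (show 2 * q + 2 < 2 * q + 3 by omega)
    have h3 := len_strictMono (show 2 * q + 3 < 2 * q + 4 by omega)
    have h4 := len_strictMono (show 2 * q + 4 < 2 * q + 5 by omega)
    rw [show 2 * (q + 1) + 1 = 2 * q + 3 by ring, show 2 * (q + 1) + 3 = 2 * q + 5 by ring]
    unfold peak
    omega
  have hsum := Finset.sum_le_sum hterm
  rw [Finset.sum_add_distrib, Finset.sum_const, Finset.card_range, smul_eq_mul] at hsum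
  rw [Finset.sum_range_succ] at h
  have hnat : 2 * peak q + 2 * ∑ p ∈ Finset.range (q + 1), len (2 * (p + 1) + 1) +
      2 * len (2 * q + 1) ≤ complexity up (peak q) + 4 + 6 * (q + 1) := by omega
  have hreal : 2 * (peak q : ℝ) + 2 * ∑ p ∈ Finset.range (q + 1), oddLen (p + 1) +
      2 * oddLen q ≤ complexity up (peak q) + 4 + 6 * (q + 1) := by
    unfold oddLen
    exact_mod_cast hnat
  have hS := sum_oddLen_ge (q + 2)
  rw [Finset.sum_range_succ'] at hS
  have h0 : oddLen 0 = 2 := by simp [oddLen, len_one]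
  have hpk : (peak q : ℝ) = oddLen q + oddLen (q + 1) := by
    simp only [peak, oddLen]
    push_cast
    rfl
  have hb := mul_le_mul_of_nonneg_left (oddLen_succ_bounds (q + 1)).1
    (show 0 ≤ (√3 - 1) / 2 by linarith)
  -- After x_{q+2} is eliminated, the excess over (4 + √3/3)(x_q + x_{q+1}) is (2√3/3 - 1)(x_{q+1} -
  -- (2 + √3) x_q), up to an error linear in q.
  have hb' := mul_le_mul_of_nonneg_left (oddLen_succ_bounds q).1
    (show 0 ≤ 2 * √3 / 3 - 1 by linarith)
  have e : (√3 - 1) / 2 * (oddLen (q + 1 + 1) - (2 + √3) * oddLen (q + 1)) =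
      (√3 - 1) / 2 * oddLen (q + 2) - (√3 + 1) / 2 * oddLen (q + 1) := by
    linear_combination (-(oddLen (q + 1)) / 2) * hsq
  have e' : (2 * √3 / 3 - 1) * (oddLen (q + 1) - (2 + √3) * oddLen q) =
      (2 * √3 / 3 - 1) * oddLen (q + 1) - √3 / 3 * oddLen q := by
    linear_combination (-2 / 3 * oddLen q) * hsq
  rw [e] at hb
  rw [e'] at hb'
  rw [hpk] at hreal ⊢
  have hq : (0 : ℝ) ≤ q := Nat.cast_nonneg q
  push_cast at hS
  linarith

theorem two_pow_le_oddLen (q : ℕ) : 2 ^ q ≤ oddLen q := by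
  have h : ∀ p, 2 ≤ oddLen p ∧ 2 * oddLen p + 1 ≤ oddLen (p + 1) := by
    intro p
    induction p with
    | zero =>
      simp only [oddLen, zero_add, mul_zero, mul_one, Nat.reduceAdd, len_one, len_three]
      norm_num
    | succ p ih =>
      have := (oddLen_recurrence p).1
      constructor <;> linarith
  induction q with
  | zero => linarith [(h 0).1]
  | succ q ih =>
    rw [pow_succ]
    linarith [(h q).2]

/-! ### The constant and the limit superior -/

theorem tau_quotient : 4 + (tau' + 5) / (tau + 5) * (2 * tau / (tau - 1)) = 4 + √3 / 3 := by
  have hsq : √3 ^ 2 = 3 := Real.sq_sqrt (by norm_num)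
  have hs : 0 ≤ √3 := Real.sqrt_nonneg 3
  unfold tau tau'
  have h1 : 7 + 4 * √3 + 5 ≠ 0 := by positivity
  have h2 : 7 + 4 * √3 - 1 ≠ 0 := by
    have : 0 < 7 + 4 * √3 - 1 := by linarith
    exact this.ne'
  field_simp
  ring_nf
  rw [show √3 ^ 3 = √3 ^ 2 * √3 by ring, hsq]
  ring

theorem tendsto_peak_ratio :
    Tendsto (fun q : ℕ => (4 + √3 / 3) - 400 * ((q : ℝ) + 1) / peak q) atTop
      (nhds (4 + √3 / 3)) := by
  have h0 : Tendsto (fun q : ℕ => 400 * ((q : ℝ) + 1) / 2 ^ q) atTop (nhds 0) := by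
    have h1 := tendsto_pow_const_div_const_pow_of_one_lt 1 (show (1 : ℝ) < 2 by norm_num)
    have h2 := tendsto_pow_const_div_const_pow_of_one_lt 0 (show (1 : ℝ) < 2 by norm_num)
    have h3 := (h1.add h2).const_mul 400
    rw [add_zero, mul_zero] at h3
    refine h3.congr fun q => ?_
    rw [pow_one, pow_zero, ← add_div, mul_div_assoc]
  have h1 : Tendsto (fun q : ℕ => 400 * ((q : ℝ) + 1) / peak q) atTop (nhds 0) := by
    refine squeeze_zero (fun q => by positivity) (fun q => ?_) h0
    have h : (2 : ℝ) ^ q ≤ peak q := by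
      refine (two_pow_le_oddLen q).trans ?_
      unfold oddLen peak
      exact_mod_cast Nat.le_add_right _ _
    gcongr
  simpa using h1.const_sub (4 + √3 / 3)

theorem peak_ge (q : ℕ) : q ≤ peak q := by
  have : 2 * q + 1 ≤ len (2 * q + 1) := len_strictMono.le_apply
  unfold peak
  omega

theorem tendsto_peak : Tendsto peak atTop atTop := tendsto_atTop_mono peak_ge tendsto_id

/-- The limit superior dominates that along the peak lengths, where the error term tends to 0. In
`EReal` no upper bound for C(n)/n is needed. -/
theorem le_limsup_complexity :
    ((4 + √3 / 3 : ℝ) : EReal) ≤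
      limsup (fun n : ℕ => (((complexity up n : ℝ) / (n : ℝ) : ℝ) : EReal)) atTop := by
  have h1 : Tendsto (fun q : ℕ => (((4 + √3 / 3) - 400 * ((q : ℝ) + 1) / peak q : ℝ) : EReal))
      atTop (nhds ((4 + √3 / 3 : ℝ) : EReal)) :=
    (continuous_coe_real_ereal.tendsto _).comp tendsto_peak_ratio
  rw [← h1.limsup_eq]
  calc _ ≤ limsup (fun q : ℕ => (((complexity up (peak q) : ℝ) / (peak q : ℝ) : ℝ) : EReal))
        atTop := by
        refine limsup_le_limsup ((eventually_ge_atTop 1).mono fun q hq => ?_)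
        have hpos : (0 : ℝ) < peak q := by
          have := peak_ge q
          exact_mod_cast (by omega : 0 < peak q)
        refine EReal.coe_le_coe_iff.2 ?_
        rw [le_div_iff₀ hpos, sub_mul, div_mul_cancel₀ _ hpos.ne']
        exact complexity_peak_ge q
    _ ≤ _ := by
        have := limsup_comp (fun n : ℕ => (((complexity up n : ℝ) / (n : ℝ) : ℝ) : EReal)) peak atTop
        simp only [Function.comp_def] at this
        rw [this]
        exact limsup_le_limsup_of_le tendsto_peak

end PseudoStd

theorem mainTheorem3 :
    ((4 + (PseudoStd.tau' + 5) / (PseudoStd.tau + 5) *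
          (2 * PseudoStd.tau / (PseudoStd.tau - 1)) : ℝ) : EReal) ≤
        limsup (fun n : ℕ => (((PseudoStd.complexity PseudoStd.up n : ℝ) / (n : ℝ) : ℝ) : EReal))
          atTop ∧
      (4.57735 : ℝ) ≤ 4 + (PseudoStd.tau' + 5) / (PseudoStd.tau + 5) *
          (2 * PseudoStd.tau / (PseudoStd.tau - 1)) ∧
      4 + (PseudoStd.tau' + 5) / (PseudoStd.tau + 5) *
          (2 * PseudoStd.tau / (PseudoStd.tau - 1)) < (4.577351 : ℝ) ∧
      ((4.57735 : ℝ) : EReal) ≤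
        limsup (fun n : ℕ => (((PseudoStd.complexity PseudoStd.up n : ℝ) / (n : ℝ) : ℝ) : EReal))
          atTop ∧
      {n : ℕ | (4.5 : ℝ) * (n : ℝ) < (PseudoStd.complexity PseudoStd.up n : ℝ)}.Infinite := by
  obtain ⟨hs1, hs2⟩ := PseudoStd.sqrt_three_bounds
  have h := PseudoStd.le_limsup_complexity
  have hle : (4.57735 : ℝ) ≤ 4 + √3 / 3 := by norm_num at hs1 ⊢; linarith
  rw [PseudoStd.tau_quotient]
  refine ⟨h, hle, by norm_num at hs2 ⊢; linarith, (EReal.coe_le_coe_iff.2 hle).trans h, ?_⟩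
  rw [← Nat.frequently_atTop_iff_infinite]
  have hlt : ((4.5 : ℝ) : EReal) <
      limsup (fun n : ℕ => (((PseudoStd.complexity PseudoStd.up n : ℝ) / (n : ℝ) : ℝ) : EReal))
        atTop :=
    (EReal.coe_lt_coe_iff.2 (lt_of_lt_of_le (by norm_num) hle)).trans_le h
  refine ((frequently_lt_of_lt_limsup (by isBoundedDefault) hlt).and_eventually
    (eventually_gt_atTop 0)).mono fun n hn => ?_
  exact (lt_div_iff₀ (by exact_mod_cast hn.2)).1 (EReal.coe_lt_coe_iff.1 hn.1)
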